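/- Setting. Let $X$ be a finite non-empty set with $N$ points, $E_x$ the expectation for the uniform distribution on $X$, and, for $g:X\to\mathbb R$, $|g|_1=E_x|g(x)|$, $|g|_2=(E_x\,g(x)^2)^{1/2}$. A statistical query about a target $f:X\to\{-1,+1\}$ is a pair $(\psi,\tau)$ with $\psi:X\times\{-1,+1\}\to\{-1,+1\}$; the oracle may return any real $v$ with $|E_x[\psi(x,f(x))]-v|\le\tau$. For an integer $p\ge 0$ and reals $r,q>0$, a class $F$ of functions $X\to\{-1,+1\}$ is called weakly SQ-learnable with parameters $(p,r,q)$ if there is one deterministic, adaptive (computationally unbounded) algorithm which, for every $f\in F$ and whatever valid answers the oracle gives, asks at most $p$ queries, each of tolerance at least $1/r$, and outputs $u:X\to\{-1,+1\}$ with $\Pr_x[u(x)\ne f(x)]\le \frac12-\frac1q$. Put $T=\max\{2r,q\}$. For a random function $f:X\to\{-1,+1\}$ and $t\in\mathbb R$, let $(\ast)_t$ be the condition $$E_f\big[\,E_x[g(x)f(x)]^2\,\big]\ \le\ \tfrac1N|g|_2^2+|g|_1^2\,e^{-t}\qquad\text{for every } g:X\to\mathbb R .$$ Corollary. (1) Let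 $F$ be a class of functions $X\to\{-1,+1\}$, let $f$ be a random function that lies in $F$ almost surely, and suppose that $(\ast)_t$ holds. Then $F$ is not weakly SQ-learnable with parameters $(p,r,q)$ unless $$(p+1)\,T^2\,\big(\tfrac1N+e^{-t}\big)\ \ge\ 4 .$$ In particular, if $p\ge1$ and $e^{t}<N$, then it is not weakly SQ-learnable with parameters $(p,r,q)$ unless $p\,T^2>e^{t}$ and $p\,T>e^{t/2}$. (2) Let $n\ge1$, $h\ge0$ be integers, and let $X=\{x\in\{-1,+1\}^n: v\cdot x>0\}$, where $v\in\mathbb R^n$ is such that $v\cdot x\ne0$ for all $x\in\{-1,+1\}^n$ (so $N=2^{n-1}$). For matrices $W=(W^{(1)},\dots,W^{(h)})$ in $\mathbb R^{n\times n}$ let $x^{(0)}=x$, $x^{(i)}=\mathrm{sgn}(W^{(i)}x^{(i-1)})$ (coordinatewise, $\mathrm{sgn}(0)=1$), and let $f_W(x)=x^{(h)}_j$ for a fixed coordinate $j$. Let $F$ be the class of all functions $f_W:X\to\{-1,+1\}$. Let $c>0$ and suppose that, when all the entries of the $W^{(i)}$ are independent $N(0,1/n)$, the random function $f_W$ satisfies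 $(\ast)_t$ with $t=ch$. Then $F$ is not weakly SQ-learnable with parameters $(p,r,q)$ unless $(p+1)\,T^2\,(2^{-(n-1)}+e^{-ch})\ge4$. In particular, for $p\ge1$: if $e^{ch}<2^{n-1}$, it is not weakly SQ-learnable with parameters $(p,r,q)$ unless $p\,T^2>e^{ch}$ and $p\,T>e^{ch/2}$; and if $h<n$, it is not weakly SQ-learnable with parameters $(p,r,q)$ unless $p\,T^2\ge e^{c'h}$ and $p\,T\ge e^{c'h/2}$, where $c'=\min\{c,\log 2\}$. -/

import Mathlib

open MeasureTheory ProbabilityTheory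

noncomputable section

namespace SQ

/-- The expectation `E_x[g(x)]` for `x` uniform on the finite set `X`. -/
def avg {X : Type*} [Fintype X] (g : X → ℝ) : ℝ :=
  (∑ x, g x) / (Fintype.card X : ℝ)

/-- A sign in `{-1, +1}` as a real number. -/
def toReal (s : ℤˣ) : ℝ := ((s : ℤ) : ℝ)

/-- The probability that `a` and `b` disagree at a uniform point of `X`. -/
def disagreement {X : Type*} [Fintype X] (a b : X → ℤˣ) : ℝ :=
  avg fun x => if a x = b x then 0 else 1

/-- A (deterministic, adaptive, computationally unbounded) statistical query algorithm: it either
stops with a hypothesis, or asks a query `(ψ, τ)` with `ψ : X × {-1, +1} → {-1, +1}` and tolerance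
`τ`, and continues depending on the real number that the oracle returns. -/
inductive Algorithm (X : Type*) where
  | output (hyp : X → ℤˣ) : Algorithm X
  | query (ψ : X → ℤˣ → ℤˣ) (τ : ℝ) (next : ℝ → Algorithm X) : Algorithm X

/-- `A.Learns f p τ₀ ε`: whatever valid answers the oracle STAT(f, uniform) gives (to a query
`(ψ, τ)` it may give any `v` with `|E_x[ψ(x, f(x))] - v| ≤ τ`), the algorithm `A` asks at most `p`
queries, each of tolerance at least `τ₀`, and then outputs an `ε`-approximation to `f`. -/
def Algorithm.Learns {X : Type*} [Fintype X] (f : X → ℤˣ) :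
    Algorithm X → (p : ℕ) → (τ₀ ε : ℝ) → Prop
  | .output hyp, _, _, ε => disagreement hyp f ≤ ε
  | .query _ _ _, 0, _, _ => False
  | .query ψ τ next, p + 1, τ₀, ε =>
      τ₀ ≤ τ ∧ ∀ v : ℝ, |avg (fun x => toReal (ψ x (f x))) - v| ≤ τ →
        Algorithm.Learns f (next v) p τ₀ ε

/-- The concept class `F` is weakly SQ-learnable with respect to the uniform distribution on `X`
with at most `p` queries of tolerance at least `1/r`, up to error `1/2 - 1/q`: a single algorithm
works for every `f ∈ F`. -/
def WeaklyLearnable {X : Type*} [Fintype X] (F : Set (X → ℤˣ)) (p : ℕ) (r q : ℝ) : Prop :=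
  ∃ A : Algorithm X, ∀ f ∈ F, A.Learns f p (1 / r) (1 / 2 - 1 / q)

/-- The random function `f` satisfies, for every fixed real function `g`,
`E_f[ E_x[g(x) f(x)]^2 ] ≤ (1/N) |g|_2^2 + |g|_1^2 exp(-t)`, where `N = |X|`. -/
def SmallCorrelations {Ω X : Type*} [MeasurableSpace Ω] [Fintype X] (μ : Measure Ω)
    (f : Ω → X → ℤˣ) (t : ℝ) : Prop :=
  ∀ g : X → ℝ,
    ∫ ω, (avg fun x => g x * toReal (f ω x)) ^ 2 ∂μ ≤
      1 / (Fintype.card X : ℝ) * avg (fun x => g x ^ 2) +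
        (avg fun x => |g x|) ^ 2 * Real.exp (-t)

/-- The sign activation. -/
def sgn (t : ℝ) : ℤˣ := if 0 ≤ t then 1 else -1

/-- The weights of a network with `h` layers of width `n`: entry `(j, k)` of the matrix of layer
`i` is `W i j k`. -/
abbrev Weights (n h : ℕ) : Type := Fin h → Fin n → Fin n → ℝ

/-- The output vector of the depth-`h` sign network, `x^(i) = sgn(W^(i) x^(i-1))`, `x^(0) = x`. -/
def signNetwork {n : ℕ} : (h : ℕ) → Weights n h → (Fin n → ℤˣ) → Fin n → ℤˣ
  | 0, _, x => x
  | h + 1, W, x => fun j =>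
      sgn (∑ k, W (Fin.last h) j k * toReal (signNetwork h (fun i => W i.castSucc) x k))

/-- Random weights: all entries independent with law `N(0, 1/n)`. -/
def weightMeasure (n h : ℕ) : Measure (Weights n h) :=
  Measure.pi fun _ => Measure.pi fun _ => Measure.pi fun _ => gaussianReal 0 (1 / (n : NNReal))

/-- The inputs in `{-1, +1}^n` on the positive side of the hyperplane orthogonal to `v`. -/
def halfCube {n : ℕ} (v : Fin n → ℝ) : Finset (Fin n → ℤˣ) :=
  Finset.univ.filter fun x => 0 < ∑ i, v i * toReal (x i)

/-- The function on the half cube computed by the `j`-th output unit of the network. -/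
def networkFunction {n : ℕ} (h : ℕ) (v : Fin n → ℝ) (j : Fin n) (W : Weights n h) :
    halfCube v → ℤˣ :=
  fun x => signNetwork h W x j

end SQ

end

namespace SQ

/-! Answer every query as if the label were a fair coin independent of `x`. The algorithm then
follows one path, the same for every target, and this path fixes at most `p + 1` functions bounded
by 1: the label coefficients of its queries and its hypothesis (`Algorithm.correlations`). If all
these answers are valid for `f`, the hypothesis has correlation at least `2/q` with `f`; if not, the
label coefficient of some query has correlation above its tolerance, hence above `1/r`. Either way
some listed function has correlation at least `2/T` (`Algorithm.Learns.exists_correlation`). So the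
sum of squared correlations over the list is almost surely at least `4/T²`, while its expectation is
at most `(p + 1)(1/N + exp(-t))` (`SmallCorrelations.integral_list_sum_le`). Comparing the two gives
`WeaklyLearnable.four_le`; the rest is arithmetic and the size of the half cube. -/

theorem abs_toReal (s : ℤˣ) : |toReal s| = 1 := by
  rcases Int.units_eq_one_or s with rfl | rfl <;> simp [toReal]

theorem toReal_neg (s : ℤˣ) : toReal (-s) = -toReal s := by
  simp [toReal]

section Avg

variable {X : Type*} [Fintype X]

theorem avg_add (g k : X → ℝ) : avg (fun x => g x + k x) = avg g + avg k := by
  simp only [avg, Finset.sum_add_distrib, add_div]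

theorem avg_const_mul (c : ℝ) (g : X → ℝ) : avg (fun x => c * g x) = c * avg g := by
  simp only [avg, ← Finset.mul_sum, mul_div_assoc]

theorem avg_const [Nonempty X] (c : ℝ) : avg (fun _ : X => c) = c := by
  simp [avg]

theorem avg_nonneg {g : X → ℝ} (hg : ∀ x, 0 ≤ g x) : 0 ≤ avg g :=
  div_nonneg (Finset.sum_nonneg fun x _ => hg x) (Nat.cast_nonneg _)

theorem avg_mono {g k : X → ℝ} (hgk : ∀ x, g x ≤ k x) : avg g ≤ avg k :=
  div_le_div_of_nonneg_right (Finset.sum_le_sum fun x _ => hgk x) (Nat.cast_nonneg _)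

theorem abs_avg_le (g : X → ℝ) : |avg g| ≤ avg fun x => |g x| := by
  rw [avg, abs_div, Nat.abs_cast]
  exact div_le_div_of_nonneg_right (Finset.abs_sum_le_sum_abs _ _) (Nat.cast_nonneg _)

theorem avg_mul_eq_one_sub_disagreement [Nonempty X] (u f : X → ℤˣ) :
    avg (fun x => toReal (u x) * toReal (f x)) = 1 - 2 * disagreement u f := by
  have h : (fun x => toReal (u x) * toReal (f x)) =
      fun x => 1 + (-2) * (if u x = f x then (0 : ℝ) else 1) := by
    funext x
    rcases Int.units_eq_one_or (u x) with h1 | h1 <;>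
      rcases Int.units_eq_one_or (f x) with h2 | h2 <;> rw [h1, h2] <;> simp [toReal] <;> norm_num
  rw [h, avg_add, avg_const, avg_const_mul, disagreement]
  ring

end Avg

/-! ### Label-blind answers to statistical queries -/

section Queries

variable {X : Type*}

/-- The part of a query that does not depend on the label. -/
noncomputable def evenPart (ψ : X → ℤˣ → ℤˣ) (x : X) : ℝ := (toReal (ψ x 1) + toReal (ψ x (-1))) / 2

/-- The coefficient of the label in a query. -/
noncomputable def oddPart (ψ : X → ℤˣ → ℤˣ) (x : X) : ℝ := (toReal (ψ x 1) - toReal (ψ x (-1))) / 2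

/-- Every function of a sign is affine in that sign. -/
theorem toReal_query (ψ : X → ℤˣ → ℤˣ) (x : X) (s : ℤˣ) :
    toReal (ψ x s) = evenPart ψ x + oddPart ψ x * toReal s := by
  rcases Int.units_eq_one_or s with rfl | rfl <;> simp [toReal, evenPart, oddPart] <;> ring

theorem abs_oddPart_le (ψ : X → ℤˣ → ℤˣ) (x : X) : |oddPart ψ x| ≤ 1 := by
  have h1 := abs_toReal (ψ x 1)
  have h2 := abs_toReal (ψ x (-1))
  have h3 := abs_sub (toReal (ψ x 1)) (toReal (ψ x (-1)))
  rw [oddPart, abs_div, abs_two]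
  linarith

variable [Fintype X]

/-- The functions whose correlation with the target is tested by the first `p` queries and by the
hypothesis of an algorithm, when the oracle ignores the label. -/
noncomputable def Algorithm.correlations : Algorithm X → ℕ → List (X → ℝ)
  | .output u, _ => [fun x => toReal (u x)]
  -- The query budget is exceeded; `Learns` is false here, so no correlation is needed.
  | .query _ _ _, 0 => []
  | .query ψ _ next, p + 1 => oddPart ψ :: (next (avg (evenPart ψ))).correlations p

theorem Algorithm.length_correlations_le (A : Algorithm X) (p : ℕ) :
    (A.correlations p).length ≤ p + 1 := by
  induction A generalizing p with
  | output u => simp [correlations]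
  | query ψ τ next ih =>
    cases p with
    | zero => simp [correlations]
    | succ p => simpa [correlations] using ih _ p

theorem Algorithm.abs_le_one_of_mem_correlations (A : Algorithm X) (p : ℕ) {g : X → ℝ}
    (hg : g ∈ A.correlations p) (x : X) : |g x| ≤ 1 := by
  induction A generalizing p with
  | output u =>
    simp only [correlations, List.mem_singleton] at hg
    subst hg
    exact (abs_toReal _).le
  | query ψ τ next ih =>
    cases p with
    | zero => simp [correlations] at hg
    | succ p =>
      simp only [correlations, List.mem_cons] at hg
      rcases hg with rfl | hg
      · exact abs_oddPart_le ψ x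
      · exact ih _ p hg

/-- The error of the label-blind answer is exactly the correlation of `oddPart ψ` with `f`: if it is
within tolerance, the induction continues along that branch, and otherwise `oddPart ψ` is the
witness. -/
theorem Algorithm.Learns.exists_correlation [Nonempty X] {f : X → ℤˣ} {A : Algorithm X} {p : ℕ}
    {τ₀ ε s : ℝ} (hA : A.Learns f p τ₀ ε) (hτ : s ≤ τ₀) (hε : s ≤ 1 - 2 * ε) :
    ∃ g ∈ A.correlations p, s ≤ |avg fun x => g x * toReal (f x)| := by
  induction A generalizing p with
  | output u =>
    refine ⟨fun x => toReal (u x), by simp [correlations], ?_⟩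
    have h : disagreement u f ≤ ε := by simpa [Learns] using hA
    rw [avg_mul_eq_one_sub_disagreement]
    exact le_trans (by linarith) (le_abs_self _)
  | query ψ τ next ih =>
    cases p with
    | zero => simp [Learns] at hA
    | succ p =>
      obtain ⟨hτ', hnext⟩ : τ₀ ≤ τ ∧ ∀ v : ℝ, |avg (fun x => toReal (ψ x (f x))) - v| ≤ τ →
        Algorithm.Learns f (next v) p τ₀ ε := by simpa only [Learns] using hA
      have h : avg (fun x => toReal (ψ x (f x))) - avg (evenPart ψ) =
          avg fun x => oddPart ψ x * toReal (f x) := by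
        simp only [toReal_query]
        rw [avg_add]
        exact add_sub_cancel_left _ _
      by_cases hv : |avg fun x => oddPart ψ x * toReal (f x)| ≤ τ
      · obtain ⟨g, hg, hgs⟩ := ih _ (hnext (avg (evenPart ψ)) (by rwa [h]))
        exact ⟨g, by simp [correlations, hg], hgs⟩
      · exact ⟨oddPart ψ, by simp [correlations], by linarith [not_le.1 hv]⟩

end Queries

/-! ### The second-moment bound -/

section LowerBound

variable {X Ω : Type*} [Fintype X] [MeasurableSpace Ω] {μ : Measure Ω} {f : Ω → X → ℤˣ}

theorem integrable_sq_correlation [IsFiniteMeasure μ]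
    (hf : ∀ x, Measurable fun ω => toReal (f ω x)) (g : X → ℝ) :
    Integrable (fun ω => (avg fun x => g x * toReal (f ω x)) ^ 2) μ := by
  refine Integrable.of_bound (C := (avg fun x => |g x|) ^ 2) ?_ (ae_of_all _ fun ω => ?_)
  · refine Measurable.aestronglyMeasurable ?_
    unfold avg
    exact ((Finset.measurable_sum _ fun x _ => (hf x).const_mul (g x)).div_const _).pow_const 2
  · rw [Real.norm_eq_abs, abs_pow]
    refine pow_le_pow_left₀ (abs_nonneg _) ((abs_avg_le _).trans_eq ?_) 2
    simp only [abs_mul, abs_toReal, mul_one]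

theorem SmallCorrelations.integral_le [Nonempty X] {t : ℝ} (h : SmallCorrelations μ f t)
    {g : X → ℝ} (hg : ∀ x, |g x| ≤ 1) :
    ∫ ω, (avg fun x => g x * toReal (f ω x)) ^ 2 ∂μ ≤
      1 / (Fintype.card X : ℝ) + Real.exp (-t) := by
  have h1 : avg (fun x => |g x|) ≤ 1 := (avg_mono hg).trans_eq (avg_const 1)
  have h2 : avg (fun x => g x ^ 2) ≤ 1 :=
    (avg_mono fun x => (sq_le_one_iff_abs_le_one (g x)).2 (hg x)).trans_eq (avg_const 1)
  have h3 : 0 ≤ avg (fun x => |g x|) := avg_nonneg fun x => abs_nonneg _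
  refine (h g).trans (add_le_add ?_ ?_)
  · exact mul_le_of_le_one_right (by positivity) h2
  · exact mul_le_of_le_one_left (Real.exp_pos _).le (pow_le_one₀ h3 h1)

theorem SmallCorrelations.integral_list_sum_le [Nonempty X] [IsFiniteMeasure μ] {t : ℝ}
    (h : SmallCorrelations μ f t) (hf : ∀ x, Measurable fun ω => toReal (f ω x))
    (L : List (X → ℝ)) (hL : ∀ g ∈ L, ∀ x, |g x| ≤ 1) :
    Integrable (fun ω => (L.map fun g => (avg fun x => g x * toReal (f ω x)) ^ 2).sum) μ ∧
      ∫ ω, (L.map fun g => (avg fun x => g x * toReal (f ω x)) ^ 2).sum ∂μ ≤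
        L.length * (1 / (Fintype.card X : ℝ) + Real.exp (-t)) := by
  induction L with
  | nil => simp
  | cons g L ih =>
    obtain ⟨hint, hle⟩ := ih fun k hk => hL k (List.mem_cons_of_mem _ hk)
    have hg := integrable_sq_correlation (μ := μ) hf g
    simp only [List.map_cons, List.sum_cons, List.length_cons]
    refine ⟨hg.add hint, ?_⟩
    rw [integral_add hg hint]
    have := h.integral_le (hL g List.mem_cons_self)
    push_cast
    linarith

theorem WeaklyLearnable.four_le [Nonempty X] [IsProbabilityMeasure μ] {F : Set (X → ℤˣ)} {t : ℝ}
    {p : ℕ} {r q : ℝ} (hF : WeaklyLearnable F p r q)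
    (hf : ∀ x, Measurable fun ω => toReal (f ω x)) (hfF : ∀ᵐ ω ∂μ, f ω ∈ F)
    (hcorr : SmallCorrelations μ f t) (hr : 0 < r) (hq : 0 < q) :
    4 ≤ ((p : ℝ) + 1) * max (2 * r) q ^ 2 * (1 / (Fintype.card X : ℝ) + Real.exp (-t)) := by
  obtain ⟨A, hA⟩ := hF
  set T := max (2 * r) q with hT
  have hT0 : 0 < T := lt_max_of_lt_right hq
  -- `T` is chosen so that `2/T` lies below both the tolerance `1/r` and the advantage `2/q`.
  have hs1 : 2 / T ≤ 1 / r := by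
    rw [div_le_div_iff₀ hT0 hr, one_mul]
    exact le_max_left _ _
  have hs2 : 2 / T ≤ 1 - 2 * (1 / 2 - 1 / q) := by
    have : 2 / T ≤ 2 / q := div_le_div_of_nonneg_left (by norm_num) hq (le_max_right _ _)
    refine this.trans_eq ?_
    ring
  obtain ⟨hint, hle⟩ := hcorr.integral_list_sum_le hf (A.correlations p)
    fun g hg => A.abs_le_one_of_mem_correlations p hg
  have hlow : (2 / T) ^ 2 ≤ ∫ ω, ((A.correlations p).map fun g =>
      (avg fun x => g x * toReal (f ω x)) ^ 2).sum ∂μ := by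
    have hc : ∫ _ω, (2 / T) ^ 2 ∂μ = (2 / T) ^ 2 := by simp
    rw [← hc]
    refine integral_mono_ae (integrable_const _) hint ?_
    filter_upwards [hfF] with ω hω
    obtain ⟨g, hg, hgs⟩ := (hA _ hω).exists_correlation hs1 hs2
    refine le_trans ?_ (List.single_le_sum (fun y hy => ?_) _ (List.mem_map_of_mem hg))
    · rw [← sq_abs (avg _)]
      exact pow_le_pow_left₀ (by positivity) hgs 2
    · obtain ⟨k, -, rfl⟩ := List.mem_map.1 hy
      exact sq_nonneg _
  have hlen : ((A.correlations p).length : ℝ) ≤ (p : ℝ) + 1 := by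
    exact_mod_cast A.length_correlations_le p
  have hfin := (hlow.trans hle).trans (mul_le_mul_of_nonneg_right hlen
    (by positivity : 0 ≤ 1 / (Fintype.card X : ℝ) + Real.exp (-t)))
  rw [div_pow, div_le_iff₀ (by positivity)] at hfin
  linarith

end LowerBound

/-! ### Simplified forms of the bound -/

/-- As `P ≥ 1`, `P T² ≤ (P T)²`; take square roots. -/
theorem exp_half_lt {a P T : ℝ} (hP : 1 ≤ P) (hT : 0 < T) (h : Real.exp a < P * T ^ 2) :
    Real.exp (a / 2) < P * T := by
  refine lt_of_pow_lt_pow_left₀ 2 (by positivity) ?_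
  rw [← Real.exp_nat_mul, Nat.cast_ofNat, mul_div_cancel₀ _ (two_ne_zero)]
  nlinarith [mul_le_mul_of_nonneg_right hP (by positivity : 0 ≤ P * T ^ 2)]

theorem exp_half_le {a P T : ℝ} (hP : 1 ≤ P) (hT : 0 < T) (h : Real.exp a ≤ P * T ^ 2) :
    Real.exp (a / 2) ≤ P * T := by
  refine le_of_sq_le_sq ?_ (by positivity)
  rw [← Real.exp_nat_mul, Nat.cast_ofNat, mul_div_cancel₀ _ (two_ne_zero)]
  nlinarith [mul_le_mul_of_nonneg_right hP (by positivity : 0 ≤ P * T ^ 2)]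

/-- The 4 is absorbed by `P + 1 ≤ 2P` and the factor 2 in the bound on `b`. -/
theorem exp_le_of_four_le {a P T b : ℝ} (hP : 1 ≤ P) (hT : 0 < T)
    (h : 4 ≤ (P + 1) * T ^ 2 * b) (hb : b ≤ 2 * Real.exp (-a)) : Real.exp a ≤ P * T ^ 2 := by
  have h1 : (P + 1) * T ^ 2 * b ≤ (2 * P) * T ^ 2 * (2 * Real.exp (-a)) := by
    have : (P + 1) * T ^ 2 ≤ (2 * P) * T ^ 2 :=
      mul_le_mul_of_nonneg_right (by linarith) (by positivity)
    exact (mul_le_mul_of_nonneg_left hb (by positivity)).trans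
      (mul_le_mul_of_nonneg_right this (by positivity))
  have h2 : 1 ≤ P * T ^ 2 * Real.exp (-a) := by linarith
  rwa [Real.exp_neg, ← div_eq_mul_inv, one_le_div (Real.exp_pos a)] at h2

theorem exp_lt_of_four_le {a P T b : ℝ} (hP : 1 ≤ P) (hT : 0 < T)
    (h : 4 ≤ (P + 1) * T ^ 2 * b) (hb : b < 2 * Real.exp (-a)) : Real.exp a < P * T ^ 2 := by
  have h1 : (P + 1) * T ^ 2 * b < (2 * P) * T ^ 2 * (2 * Real.exp (-a)) := by
    have : (P + 1) * T ^ 2 ≤ (2 * P) * T ^ 2 :=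
      mul_le_mul_of_nonneg_right (by linarith) (by positivity)
    exact (mul_lt_mul_of_pos_left hb (by positivity)).trans_le
      (mul_le_mul_of_nonneg_right this (by positivity))
  have h2 : 1 < P * T ^ 2 * Real.exp (-a) := by linarith
  rwa [Real.exp_neg, ← div_eq_mul_inv, one_lt_div (Real.exp_pos a)] at h2

theorem one_div_add_exp_neg_lt {a N : ℝ} (h : Real.exp a < N) :
    1 / N + Real.exp (-a) < 2 * Real.exp (-a) := by
  have : 1 / N < Real.exp (-a) := by
    rw [Real.exp_neg, ← one_div]
    exact one_div_lt_one_div_of_lt (Real.exp_pos a) h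
  linarith

/-! ### Half cube and sign networks -/

section Network

/-- Negation swaps the half cube with its complement, because no point lies on the hyperplane. The
index `j` forces `n ≥ 1`, so `n - 1` is not truncated. -/
theorem card_halfCube {n : ℕ} {v : Fin n → ℝ} (j : Fin n)
    (hv : ∀ x : Fin n → ℤˣ, ∑ i, v i * toReal (x i) ≠ 0) : (halfCube v).card = 2 ^ (n - 1) := by
  have hneg : ∀ x : Fin n → ℤˣ,
      ∑ i, v i * toReal ((-x) i) = -∑ i, v i * toReal (x i) := fun x => by
    simp only [Pi.neg_apply, toReal_neg, mul_neg, Finset.sum_neg_distrib]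
  have hcompl : (halfCube v)ᶜ.card = (halfCube v).card := by
    refine Finset.card_bij' (fun x _ => -x) (fun x _ => -x) (fun x hx => ?_) (fun x hx => ?_)
      (fun x _ => neg_neg x) (fun x _ => neg_neg x)
    · simp only [halfCube, Finset.mem_compl, Finset.mem_filter, Finset.mem_univ, true_and,
        not_lt, hneg] at hx ⊢
      exact neg_pos.2 (lt_of_le_of_ne hx (hv x))
    · simp only [halfCube, Finset.mem_compl, Finset.mem_filter, Finset.mem_univ, true_and,
        not_lt, hneg] at hx ⊢
      exact (neg_neg_of_pos hx).le
  have hsum := Finset.card_add_card_compl (halfCube v)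
  have hcard : Fintype.card (Fin n → ℤˣ) = 2 ^ n := by
    rw [Fintype.card_fun, Fintype.card_fin, show Fintype.card ℤˣ = 2 from rfl]
  rw [hcompl, hcard] at hsum
  obtain ⟨m, rfl⟩ : ∃ m, n = m + 1 := ⟨n - 1, by have := j.pos; omega⟩
  rw [pow_succ] at hsum
  simp only [Nat.add_sub_cancel]
  omega

theorem measurable_toReal_sgn : Measurable fun s : ℝ => toReal (sgn s) := by
  have : (fun s : ℝ => toReal (sgn s)) = fun s => if 0 ≤ s then (1 : ℝ) else -1 := by
    funext s
    unfold sgn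
    split_ifs <;> simp [toReal]
  rw [this]
  exact Measurable.ite measurableSet_Ici measurable_const measurable_const

theorem measurable_signNetwork {n : ℕ} (h : ℕ) (x : Fin n → ℤˣ) (j : Fin n) :
    Measurable fun W : Weights n h => toReal (signNetwork h W x j) := by
  induction h generalizing j with
  | zero =>
    simp only [signNetwork]
    exact measurable_const
  | succ h ih =>
    simp only [signNetwork]
    refine measurable_toReal_sgn.comp (Finset.measurable_sum _ fun k _ => Measurable.mul ?_ ?_)
    · fun_prop
    · exact (ih k).comp (measurable_pi_lambda _ fun i => measurable_pi_apply i.castSucc)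

instance isProbabilityMeasure_weightMeasure (n h : ℕ) :
    IsProbabilityMeasure (weightMeasure n h) := by
  unfold weightMeasure
  infer_instance

theorem exp_min_mul_le_two_pow {c : ℝ} {n h : ℕ} (hn : h < n) :
    Real.exp (min c (Real.log 2) * h) ≤ 2 ^ (n - 1) := by
  calc Real.exp (min c (Real.log 2) * h) ≤ Real.exp (h * Real.log 2) := by
        rw [mul_comm (h : ℝ)]
        gcongr
        exact min_le_right _ _
    _ = 2 ^ h := by rw [Real.exp_nat_mul, Real.exp_log two_pos]
    _ ≤ 2 ^ (n - 1) := pow_le_pow_right₀ one_le_two (by omega)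

end Network

end SQ

theorem mainTheorem3 :
    -- an arbitrary concept class with a probability distribution on it
    (∀ (X Ω : Type*) [Fintype X] [Nonempty X] [MeasurableSpace Ω]
        (μ : Measure Ω) [IsProbabilityMeasure μ] (F : Set (X → ℤˣ)) (f : Ω → X → ℤˣ) (t : ℝ)
        (p : ℕ) (r q : ℝ),
      (∀ x, Measurable fun ω => SQ.toReal (f ω x)) → (∀ᵐ ω ∂μ, f ω ∈ F) →
      SQ.SmallCorrelations μ f t → 0 < r → 0 < q → SQ.WeaklyLearnable F p r q →
        4 ≤ ((p : ℝ) + 1) * max (2 * r) q ^ 2 *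
            (1 / (Fintype.card X : ℝ) + Real.exp (-t)) ∧
        (1 ≤ p → Real.exp t < (Fintype.card X : ℝ) →
          Real.exp t < (p : ℝ) * max (2 * r) q ^ 2 ∧
          Real.exp (t / 2) < (p : ℝ) * max (2 * r) q)) ∧
    -- the class of random depth-`h` sign networks, on the half cube, which has `2^(n-1)` points
    (∀ (n h : ℕ) (v : Fin n → ℝ) (j : Fin n) (c : ℝ) (p : ℕ) (r q : ℝ),
      (∀ x : Fin n → ℤˣ, ∑ i, v i * SQ.toReal (x i) ≠ 0) → 0 < c →
      SQ.SmallCorrelations (SQ.weightMeasure n h) (SQ.networkFunction h v j) (c * h) →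
      0 < r → 0 < q →
      SQ.WeaklyLearnable (Set.range (SQ.networkFunction (n := n) h v j)) p r q →
        4 ≤ ((p : ℝ) + 1) * max (2 * r) q ^ 2 *
            (1 / (2 : ℝ) ^ (n - 1) + Real.exp (-(c * h))) ∧
        (1 ≤ p → Real.exp (c * h) < (2 : ℝ) ^ (n - 1) →
          Real.exp (c * h) < (p : ℝ) * max (2 * r) q ^ 2 ∧
          Real.exp (c * h / 2) < (p : ℝ) * max (2 * r) q) ∧
        (1 ≤ p → h < n →
          Real.exp (min c (Real.log 2) * h) ≤ (p : ℝ) * max (2 * r) q ^ 2 ∧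
          Real.exp (min c (Real.log 2) * h / 2) ≤ (p : ℝ) * max (2 * r) q)) := by
  refine ⟨?_, ?_⟩
  · intro X Ω _ _ _ μ _ F f t p r q hf hfF hcorr hr hq hF
    have h4 := hF.four_le hf hfF hcorr hr hq
    have hT : 0 < max (2 * r) q := lt_max_of_lt_right hq
    refine ⟨h4, fun hp ht => ?_⟩
    have hP : (1 : ℝ) ≤ p := by exact_mod_cast hp
    have h := SQ.exp_lt_of_four_le hP hT h4 (SQ.one_div_add_exp_neg_lt ht)
    exact ⟨h, SQ.exp_half_lt hP hT h⟩
  · intro n h v j c p r q hv hc hcorr hr hq hF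
    have hcard : (Fintype.card (SQ.halfCube v) : ℝ) = 2 ^ (n - 1) := by
      rw [Fintype.card_coe, SQ.card_halfCube j hv]
      norm_num
    have : Nonempty (SQ.halfCube v) := by
      rw [← Fintype.card_pos_iff, Fintype.card_coe, SQ.card_halfCube j hv]
      positivity
    have hmeas : ∀ x, Measurable fun W => SQ.toReal (SQ.networkFunction h v j W x) :=
      fun x => SQ.measurable_signNetwork h x.1 j
    have hmem : ∀ᵐ W ∂SQ.weightMeasure n h,
        SQ.networkFunction h v j W ∈ Set.range (SQ.networkFunction (n := n) h v j) :=
      Filter.Eventually.of_forall fun W => Set.mem_range_self W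
    have h4 := hF.four_le hmeas hmem hcorr hr hq
    rw [hcard] at h4
    have hT : 0 < max (2 * r) q := lt_max_of_lt_right hq
    refine ⟨h4, fun hp ht => ?_, fun hp hn => ?_⟩
    · have hP : (1 : ℝ) ≤ p := by exact_mod_cast hp
      have hlt := SQ.exp_lt_of_four_le hP hT h4 (SQ.one_div_add_exp_neg_lt ht)
      exact ⟨hlt, SQ.exp_half_lt hP hT hlt⟩
    · have hP : (1 : ℝ) ≤ p := by exact_mod_cast hp
      -- The rate `min c (log 2)` makes both `1/N` and `exp(-ch)` at most the same exponential: `log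
      -- 2` handles the first, since `h ≤ n - 1`, and `c` the second.
      have hle := SQ.exp_le_of_four_le (a := min c (Real.log 2) * h) hP hT h4 (by
        have h1 : 1 / (2 : ℝ) ^ (n - 1) ≤ Real.exp (-(min c (Real.log 2) * h)) := by
          rw [Real.exp_neg, ← one_div]
          exact one_div_le_one_div_of_le (Real.exp_pos _) (SQ.exp_min_mul_le_two_pow hn)
        have h2 : Real.exp (-(c * h)) ≤ Real.exp (-(min c (Real.log 2) * h)) := by
          gcongr
          exact min_le_left _ _
        linarith)
      exact ⟨hle, SQ.exp_half_le hP hT hle⟩
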